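/- Let $\mathcal{A}$ be a Grothendieck category. For an object $X$ write $\operatorname{projdim} X\le n$ if $\operatorname{Ext}^i(X,-)=0$ for all $i\ge n+1$, and $\operatorname{injdim} X\le n$ if $\operatorname{Ext}^i(-,X)=0$ for all $i\ge n+1$. Let $FPD(\mathcal{A})$ (resp. $FID(\mathcal{A})$) be the supremum of the finite projective (resp. finite injective) dimensions of objects of $\mathcal{A}$. Call $\mathcal{A}$ a Gorenstein category if (1) for every object $L$, $\operatorname{projdim} L<\infty$ if and only if $\operatorname{injdim} L<\infty$; (2) $FPD(\mathcal{A})<\infty$ and $FID(\mathcal{A})<\infty$; (3) $\mathcal{A}$ has a generator of finite projective dimension. It has dimension at most $n$ if moreover $FPD(\mathcal{A})\le n$ and $FID(\mathcal{A})\le n$. For a class $\mathcal{C}$ of objects, $\mathcal{C}^{\perp}$ (resp. ${}^{\perp}\mathcal{C}$) is the class of objects $Y$ with $\operatorname{Ext}^1(C,Y)=0$ (resp. $\operatorname{Ext}^1(Y,C)=0$) for all $C\in\mathcal{C}$. A pair $(\mathcal{F},\mathcal{C})$ of classes is a cotorsion pair if $\mathcal{F}^{\perp}=\mathcal{C}$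 and ${}^{\perp}\mathcal{C}=\mathcal{F}$. It is complete if for all objects $X,Y$ there are exact sequences $0\to C\to F\to X\to 0$ and $0\to Y\to C'\to F'\to 0$ with $F,F'\in\mathcal{F}$ and $C,C'\in\mathcal{C}$. It is hereditary if $\mathcal{C}$ is closed under cokernels of monomorphisms between its objects, $\mathcal{F}$ is closed under kernels of epimorphisms between its objects, and $\operatorname{Ext}^i(F,C)=0$ for all $F\in\mathcal{F}$, $C\in\mathcal{C}$, $i\ge 1$. An object $G$ is Gorenstein injective if $G\cong\operatorname{Ker}(E^0\to E^1)$ for some exact complex $\cdots\to E^{-1}\to E^0\to E^1\to\cdots$ of injective objects such that $\operatorname{Hom}(Q,E^{\bullet})$ is exact for every injective object $Q$. For an object $Y$, $Gid(Y)\in\{0,1,2,\dots\}\cup\{\infty\}$ is the least $m$ such that $\operatorname{Ker}(I^m\to I^{m+1})$ is Gorenstein injective for some injective resolution $0\to Y\to I^0\to I^1\to\cdots$, and $\infty$ if there is no such $m$. Theorem. Let $\mathcal{A}$ be a Gorenstein category and let $\mathcal{L}$ be the class of objects of $\mathcal{A}$ of finite projective dimension. Then $(\mathcal{L},\mathcal{L}^{\perp})$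 is a complete and hereditary cotorsion pair on $\mathcal{A}$, and $\mathcal{L}^{\perp}$ is exactly the class of Gorenstein injective objects of $\mathcal{A}$. If moreover $\mathcal{A}$ has dimension at most $n$, where $n\ge 0$ is an integer, then $Gid(Y)\le n$ for every object $Y$ of $\mathcal{A}$. -/

import Mathlib

open CategoryTheory CategoryTheory.Limits CategoryTheory.Abelian

universe u v

namespace GorensteinCat

section Dimensions

variable (A : Type u) [Category.{v} A] [Abelian A]

/-- The class `ℒ` of objects of finite projective dimension, where `projdim X ≤ n` means
`Ext^i(X, -) = 0` for all `i ≥ n + 1` (the category need not have enough projectives). -/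
def finiteProjDim : ObjectProperty A := fun X => projectiveDimension X < ⊤

/-- `FPD(A)`: the supremum of `projdim X` over all `X` with `projdim X < ∞`
(the zero object contributes `-∞ = ⊥`). -/
noncomputable def FPD : WithBot ℕ∞ :=
  ⨆ (X : A) (_ : projectiveDimension X < ⊤), projectiveDimension X

/-- `FID(A)`: the supremum of `injdim Y` over all `Y` with `injdim Y < ∞`. -/
noncomputable def FID : WithBot ℕ∞ :=
  ⨆ (Y : A) (_ : injectiveDimension Y < ⊤), injectiveDimension Y

end Dimensions

/-- A Grothendieck category `A` is a Gorenstein category. -/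
structure IsGorensteinCategory (A : Type u) [Category.{v} A] [Abelian A]
    [IsGrothendieckAbelian.{v} A] : Prop where
  projDim_lt_top_iff (L : A) : projectiveDimension L < ⊤ ↔ injectiveDimension L < ⊤
  FPD_lt_top : FPD A < ⊤
  FID_lt_top : FID A < ⊤
  exists_generator : ∃ L : A, IsSeparator L ∧ projectiveDimension L < ⊤

/-- A Gorenstein category has dimension at most `n`. -/
structure HasDimensionLE (A : Type u) [Category.{v} A] [Abelian A]
    [IsGrothendieckAbelian.{v} A] (n : ℕ) : Prop extends IsGorensteinCategory A where
  FPD_le : FPD A ≤ n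
  FID_le : FID A ≤ n

section Cotorsion

variable {A : Type u} [Category.{v} A] [Abelian A] [IsGrothendieckAbelian.{v} A]

/-- `𝒞^⊥`: the objects `Y` with `Ext¹(C, Y) = 0` for all `C ∈ 𝒞`. -/
def rightPerp (P : ObjectProperty A) : ObjectProperty A :=
  fun Y => ∀ X : A, P X → Subsingleton (Ext.{v} X Y 1)

/-- `^⊥𝒞`: the objects `X` with `Ext¹(X, C) = 0` for all `C ∈ 𝒞`. -/
def leftPerp (P : ObjectProperty A) : ObjectProperty A :=
  fun X => ∀ Y : A, P Y → Subsingleton (Ext.{v} X Y 1)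

/-- `(ℱ, 𝒞)` is a cotorsion pair. -/
structure IsCotorsionPair (F C : ObjectProperty A) : Prop where
  rightPerp_eq : rightPerp F = C
  leftPerp_eq : leftPerp C = F

/-- Completeness of a cotorsion pair `(ℱ, 𝒞)`: for all `X` and `Y` there are exact sequences
`0 → K → M → X → 0` and `0 → Y → K' → M' → 0` with `M, M' ∈ ℱ` and `K, K' ∈ 𝒞`. -/
structure IsCompletePair (F C : ObjectProperty A) : Prop where
  exists_left (X : A) : ∃ (K M : A) (f : K ⟶ M) (g : M ⟶ X) (w : f ≫ g = 0),
    (ShortComplex.mk f g w).ShortExact ∧ F M ∧ C K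
  exists_right (Y : A) : ∃ (K M : A) (f : Y ⟶ K) (g : K ⟶ M) (w : f ≫ g = 0),
    (ShortComplex.mk f g w).ShortExact ∧ F M ∧ C K

/-- Heredity of a cotorsion pair `(ℱ, 𝒞)`. The conditions in use in the literature (they are
equivalent under mild hypotheses) are all required: `𝒞` is closed under cokernels of
monomorphisms, `ℱ` is closed under kernels of epimorphisms, and `Ext^i(F, C) = 0` for all
`F ∈ ℱ`, `C ∈ 𝒞` and `i ≥ 1`. -/
structure IsHereditaryPair (F C : ObjectProperty A) : Prop where
  cokernel_mem (S : ShortComplex A) (hS : S.ShortExact) : C S.X₁ → C S.X₂ → C S.X₃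
  kernel_mem (S : ShortComplex A) (hS : S.ShortExact) : F S.X₂ → F S.X₃ → F S.X₁
  ext_vanishing (X Y : A) (hX : F X) (hY : C Y) (i : ℕ) (hi : 1 ≤ i) :
    Subsingleton (Ext.{v} X Y i)

end Cotorsion

section GorensteinInjective

variable {A : Type u} [Category.{v} A] [Abelian A]

/-- A complex of injectives `⋯ → E⁻¹ → E⁰ → E¹ → ⋯` that is exact and such that for every
injective object `Q` the complex of abelian groups `Hom(Q, E)` is exact. -/
structure IsCompleteInjectiveComplex (E : CochainComplex A ℤ) : Prop where
  injective (n : ℤ) : Injective (E.X n)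
  acyclic : E.Acyclic
  hom_exact (Q : A) (hQ : Injective Q) (i j k : ℤ) (hij : i + 1 = j) (hjk : j + 1 = k)
    (f : Q ⟶ E.X j) (hf : f ≫ E.d j k = 0) : ∃ g : Q ⟶ E.X i, g ≫ E.d i j = f

/-- `G` is Gorenstein injective: it is the kernel of `E⁰ → E¹` for some complete injective
resolution `E`. -/
def gorensteinInjective : ObjectProperty A := fun G =>
  ∃ E : CochainComplex A ℤ, IsCompleteInjectiveComplex E ∧ Nonempty (G ≅ kernel (E.d 0 1))

/-- The Gorenstein injective dimension of `Y`: the least `m` such that an `m`-th cosyzygy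
`Ker(I^m → I^{m+1})` of `Y` (with `0 → Y → I⁰ → I¹ → ⋯` an injective resolution) is Gorenstein
injective, and `∞` if there is no such `m`. -/
noncomputable def Gid (Y : A) : ℕ∞ :=
  ⨅ (m : ℕ) (_ : ∃ I : InjectiveResolution Y,
    gorensteinInjective (kernel (I.cocomplex.d m (m + 1)))), (m : ℕ∞)

end GorensteinInjective

end GorensteinCat

/-! Write `ℒ` for the objects of finite projective dimension and `n` for a common bound on `FPD` and
`FID`. The core is that `(ℒ, ℒ^⊥)` is cogenerated by a set, although enough projectives are not
available.

Take a generator `U ∈ ℒ`, a test object `D` for injectivity, and the injectives `Q_m` in a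
resolution of `D`; these lie in `ℒ`. Put `W = U ⊞ ∐ Q_m` and close under syzygies with respect to
copowers of `U`. The resulting objects lie in `ℒ`, and their `Ext¹`-orthogonal `syzygyPerp U W` is
closed under cosyzygies, so each `K` in it satisfies `Ext^i(Q_m, K) = 0` for all `i ≥ 1`. If
moreover `K ∈ ℒ`, then `injdim K ≤ n`, and shifting along the resolution of `D` gives `Ext¹(D, K) =
0`: `K` is injective (`exists_syzygyPerp`).

The small object argument makes the cogenerated pair complete (`isCompletePair_syzygyPerp`). Its
left class lies in `ℒ`, because `n`-th cosyzygies lie in `ℒ^⊥`. For `L ∈ ℒ`, the kernel of the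
special precover `M ⟶ L` is then in `ℒ` and orthogonal, hence injective; so `L` is a summand of `M`,
and the left class is all of `ℒ`.

Objects of `ℒ ∩ ℒ^⊥` are injective, so special precovers continue an injective resolution of an
object of `ℒ^⊥` to the left. Conversely, a cocycle object of an exact complex of injectives is an
`n`-th cosyzygy, hence lies in `ℒ^⊥`. The bound on `Gid` follows by the same shift. -/

namespace GorensteinCat

open scoped ZeroObject

/-! ### Cosyzygies -/

section Cosyzygy

variable {A : Type u} [Category.{v} A] [Abelian A] [EnoughInjectives A]

/-- The cokernel of a chosen monomorphism from `Y` to an injective object. -/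
noncomputable abbrev cosyzygy (Y : A) : A := cokernel (Injective.ι Y)

/-- The short exact sequence `0 ⟶ Y ⟶ J ⟶ cosyzygy Y ⟶ 0` with `J` injective. -/
noncomputable abbrev cosyzygySequence (Y : A) : ShortComplex A :=
  ShortComplex.mk (X₃ := cosyzygy Y) (Injective.ι Y) (cokernel.π _) (cokernel.condition _)

lemma cosyzygySequence_shortExact (Y : A) : (cosyzygySequence Y).ShortExact where
  exact := ShortComplex.exact_cokernel _
  mono_f := inferInstanceAs (Mono (Injective.ι Y))
  epi_g := inferInstanceAs (Epi (cokernel.π _))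

instance (Y : A) : Injective (cosyzygySequence Y).X₂ :=
  inferInstanceAs (Injective (Injective.under Y))

/-- The `m`-th iterated cosyzygy. -/
noncomputable def iterCosyzygy (Y : A) : ℕ → A
  | 0 => Y
  | m + 1 => cosyzygy (iterCosyzygy Y m)

end Cosyzygy

lemma shortExact_kernel {A : Type u} [Category.{v} A] [Abelian A] {X Y : A} (f : X ⟶ Y) [Epi f] :
    (ShortComplex.mk (kernel.ι f) f (kernel.condition f)).ShortExact where
  exact := ShortComplex.exact_kernel f

lemma shortExact_cokernel {A : Type u} [Category.{v} A] [Abelian A] {X Y : A} (f : X ⟶ Y)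
    [Mono f] : (ShortComplex.mk f (cokernel.π f) (cokernel.condition f)).ShortExact where
  exact := ShortComplex.exact_cokernel f

lemma shortExact_zero_id {A : Type u} [Category.{v} A] [Abelian A] (X : A) :
    (ShortComplex.mk (0 : (0 : A) ⟶ X) (𝟙 X) zero_comp).ShortExact where
  exact := (ShortComplex.exact_iff_mono _ rfl).2 inferInstance

/-! ### Dimension shifting, lifting and vanishing of `Ext` -/

section Ext

universe w

variable {A : Type u} [Category.{v} A] [Abelian A] [HasExt.{w} A]

/-- If `S` is a short exact sequence with injective middle term, then `Ext¹(X, S.X₁)` vanishes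
if and only if all morphisms `X ⟶ S.X₃` lift to `S.X₂`. -/
lemma subsingleton_ext_one_iff {S : ShortComplex A} (hS : S.ShortExact) [Injective S.X₂] (X : A) :
    Subsingleton (Ext.{w} X S.X₁ 1) ↔ ∀ g : X ⟶ S.X₃, ∃ h : X ⟶ S.X₂, h ≫ S.g = g := by
  constructor
  · intro _ g
    obtain ⟨x, hx⟩ := Ext.covariant_sequence_exact₃ X hS (Ext.mk₀ g) (zero_add 1)
      (Subsingleton.elim _ _)
    obtain ⟨h, rfl⟩ := Ext.homEquiv₀.symm.surjective x
    exact ⟨h, Ext.homEquiv₀.symm.injective (by simpa using hx)⟩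
  · intro H
    refine subsingleton_of_forall_eq 0 fun e => ?_
    obtain ⟨x, rfl⟩ := Ext.covariant_sequence_exact₁ X hS e (Ext.eq_zero_of_injective _) (zero_add 1)
    obtain ⟨g, rfl⟩ := Ext.homEquiv₀.symm.surjective x
    obtain ⟨h, rfl⟩ := H g
    simp [← Ext.mk₀_comp_mk₀]

lemma subsingleton_ext_succ_iff {S : ShortComplex A} (hS : S.ShortExact) [Injective S.X₂]
    (X : A) (i : ℕ) :
    Subsingleton (Ext.{w} X S.X₁ (i + 2)) ↔ Subsingleton (Ext.{w} X S.X₃ (i + 1)) := by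
  constructor
  · intro _
    refine subsingleton_of_forall_eq 0 fun e => ?_
    obtain ⟨x, rfl⟩ := Ext.covariant_sequence_exact₃ X hS e (n₁ := i + 2) rfl
      (Subsingleton.elim _ _)
    rw [Ext.eq_zero_of_injective x, Ext.zero_comp]
  · intro _
    refine subsingleton_of_forall_eq 0 fun e => ?_
    obtain ⟨x, rfl⟩ := Ext.covariant_sequence_exact₁ X hS e (Ext.eq_zero_of_injective _)
      (n₀ := i + 1) rfl
    rw [Subsingleton.elim x 0, Ext.zero_comp]

lemma subsingleton_ext_of_retract {X X' : A} (h : Retract X X') (Y : A) (i : ℕ)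
    [Subsingleton (Ext.{w} X' Y i)] : Subsingleton (Ext.{w} X Y i) := by
  refine subsingleton_of_forall_eq 0 fun x => ?_
  rw [← x.mk₀_id_comp, ← h.retract, ← Ext.mk₀_comp_mk₀, Ext.comp_assoc_of_second_deg_zero,
    Subsingleton.elim ((Ext.mk₀ h.r).comp x (zero_add i)) 0, Ext.comp_zero]

lemma subsingleton_ext_of_coproduct {ι : Type*} (X : ι → A) [HasCoproduct X] (Y : A) (i : ℕ)
    [Subsingleton (Ext.{w} (∐ X) Y i)] (j : ι) : Subsingleton (Ext.{w} (X j) Y i) := by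
  classical
  exact subsingleton_ext_of_retract
    { i := Sigma.ι X j, r := Sigma.π X j, retract := Sigma.ι_π_eq_id X j } Y i

lemma subsingleton_ext_of_iso_right (X : A) {Y Y' : A} (e : Y ≅ Y') (i : ℕ)
    [Subsingleton (Ext.{w} X Y i)] : Subsingleton (Ext.{w} X Y' i) := by
  refine subsingleton_of_forall_eq 0 fun x => ?_
  rw [← x.comp_mk₀_id, ← e.inv_hom_id, ← Ext.mk₀_comp_mk₀, ← Ext.comp_assoc_of_second_deg_zero,
    Subsingleton.elim (x.comp (Ext.mk₀ e.inv) (add_zero i)) 0, Ext.zero_comp]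

/-- If `Ext¹(S.X₃, Y) = 0`, then morphisms `S.X₁ ⟶ Y` extend to `S.X₂`. -/
lemma exists_extension {S : ShortComplex A} (hS : S.ShortExact) {Y : A}
    [Subsingleton (Ext.{w} S.X₃ Y 1)] (a : S.X₁ ⟶ Y) : ∃ b : S.X₂ ⟶ Y, S.f ≫ b = a := by
  obtain ⟨x, hx⟩ := Ext.contravariant_sequence_exact₁ hS Y (Ext.mk₀ a) (add_zero 1)
    (Subsingleton.elim _ _)
  obtain ⟨h, rfl⟩ := Ext.homEquiv₀.symm.surjective x
  exact ⟨h, Ext.homEquiv₀.symm.injective (by simpa using hx)⟩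

lemma exists_lift {S : ShortComplex A} (hS : S.ShortExact) {X : A}
    [Subsingleton (Ext.{w} X S.X₁ 1)] (a : X ⟶ S.X₃) : ∃ b : X ⟶ S.X₂, b ≫ S.g = a := by
  obtain ⟨x, hx⟩ := Ext.covariant_sequence_exact₃ X hS (Ext.mk₀ a) (zero_add 1)
    (Subsingleton.elim _ _)
  obtain ⟨h, rfl⟩ := Ext.homEquiv₀.symm.surjective x
  exact ⟨h, Ext.homEquiv₀.symm.injective (by simpa using hx)⟩

/-- A monomorphism with cokernel `X` has the left lifting property with respect to an
epimorphism with kernel `Y` as soon as `Ext¹(X, Y) = 0`. -/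
lemma hasLiftingProperty_of_subsingleton_ext {S T : ShortComplex A} (hS : S.ShortExact)
    (hT : T.ShortExact) [Subsingleton (Ext.{w} S.X₃ T.X₁ 1)] : HasLiftingProperty S.f T.g where
  sq_hasLift {a b} sq := by
    -- The obstruction to lifting `b` dies on `S.X₁`, where `a` provides a lift, so it comes from
    -- `Ext¹(S.X₃, T.X₁) = 0`.
    have hb : (Ext.mk₀ b).comp hT.extClass (zero_add 1) = 0 := by
      obtain ⟨x, hx⟩ := Ext.contravariant_sequence_exact₂ hS T.X₁
        ((Ext.mk₀ b).comp hT.extClass (zero_add 1)) (by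
          rw [Ext.mk₀_comp_mk₀_assoc, ← sq.w, ← Ext.mk₀_comp_mk₀_assoc]
          simp)
      rw [← hx, Subsingleton.elim x 0, Ext.comp_zero]
    obtain ⟨x, hx⟩ := Ext.covariant_sequence_exact₃ S.X₂ hT (Ext.mk₀ b) (zero_add 1) hb
    obtain ⟨l, rfl⟩ := Ext.homEquiv₀.symm.surjective x
    replace hx : l ≫ T.g = b := Ext.homEquiv₀.symm.injective (by simpa using hx)
    have := hT.mono_f
    -- The lift `l` of `b` need not restrict to `a`; the error lands in the kernel `T.X₁` and
    -- extends to `S.X₂`, which corrects `l`.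
    obtain ⟨c, hc⟩ : ∃ c : S.X₁ ⟶ T.X₁, c ≫ T.f = a - S.f ≫ l :=
      ⟨hT.exact.lift (a - S.f ≫ l) (by simp [hx, sq.w]), hT.exact.lift_f _ _⟩
    obtain ⟨d, hd⟩ := exists_extension hS c
    refine ⟨⟨{ l := l + d ≫ T.f, fac_left := ?_, fac_right := by simp [hx] }⟩⟩
    rw [Preadditive.comp_add, reassoc_of% hd, hc]
    abel

variable [EnoughInjectives A]

lemma subsingleton_ext_cosyzygy_iff (X Y : A) (i : ℕ) :
    Subsingleton (Ext.{w} X (cosyzygy Y) (i + 1)) ↔ Subsingleton (Ext.{w} X Y (i + 2)) :=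
  (subsingleton_ext_succ_iff (cosyzygySequence_shortExact Y) X i).symm

lemma subsingleton_ext_iterCosyzygy_iff (X Y : A) (m i : ℕ) :
    Subsingleton (Ext.{w} X (iterCosyzygy Y m) (i + 1)) ↔
      Subsingleton (Ext.{w} X Y (i + m + 1)) := by
  induction m generalizing i with
  | zero => rfl
  | succ m ih =>
    rw [iterCosyzygy, subsingleton_ext_cosyzygy_iff, ih (i + 1),
      show i + 1 + m + 1 = i + (m + 1) + 1 by lia]

lemma subsingleton_ext_one_iff_cosyzygy (X Y : A) :
    Subsingleton (Ext.{w} X Y 1) ↔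
      ∀ g : X ⟶ cosyzygy Y, ∃ h : X ⟶ Injective.under Y, h ≫ cokernel.π (Injective.ι Y) = g :=
  subsingleton_ext_one_iff (cosyzygySequence_shortExact Y) X

/-- Vanishing of `Ext¹` is a lifting condition, which can be solved on each summand separately;
higher degrees reduce to it by replacing `Y` with its cosyzygies. -/
lemma subsingleton_ext_coproduct {ι : Type*} (X : ι → A) [HasCoproduct X] (i : ℕ) (Y : A)
    (h : ∀ j, Subsingleton (Ext.{w} (X j) Y (i + 1))) :
    Subsingleton (Ext.{w} (∐ X) Y (i + 1)) := by
  induction i generalizing Y with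
  | zero =>
    rw [zero_add, subsingleton_ext_one_iff_cosyzygy]
    intro g
    choose l hl using fun j => (subsingleton_ext_one_iff_cosyzygy _ _).1 (h j) (Sigma.ι X j ≫ g)
    exact ⟨Sigma.desc l, Sigma.hom_ext _ _ fun j => by simpa using hl j⟩
  | succ i ih =>
    rw [← subsingleton_ext_cosyzygy_iff]
    exact ih _ fun j => (subsingleton_ext_cosyzygy_iff _ _ _).2 (h j)

lemma hasProjectiveDimensionLT_coproduct {ι : Type*} (X : ι → A) [HasCoproduct X] (n : ℕ)
    (h : ∀ j, HasProjectiveDimensionLT (X j) (n + 1)) :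
    HasProjectiveDimensionLT (∐ X) (n + 1) :=
  hasProjectiveDimensionLT_of_enoughInjectives _ _ fun Y =>
    subsingleton_ext_coproduct X n Y fun j =>
      HasProjectiveDimensionLT.subsingleton (X j) (n + 1) _ le_rfl Y

/-- An object `K` of injective dimension `≤ n` with `Ext^i(Q, K) = 0` for `i ≥ 1` and for all
injective objects `Q` occurring in the resolution of `D` satisfies `Ext¹(D, K) = 0`. -/
lemma subsingleton_ext_of_hasInjectiveDimensionLT (D K : A) (n : ℕ)
    [HasInjectiveDimensionLT K (n + 1)]
    (h : ∀ m i, Subsingleton (Ext.{w} (Injective.under (iterCosyzygy D m)) K (i + 1))) :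
    Subsingleton (Ext.{w} D K 1) := by
  -- Descending induction on `m`: by `h`, the group for `m` embeds in the one for `m + 1`, and for
  -- `m ≥ n` it vanishes by the injective dimension of `K`.
  suffices ∀ k m, n ≤ m + k → Subsingleton (Ext.{w} (iterCosyzygy D m) K (m + 1)) from
    this n 0 (by lia)
  intro k
  induction k with
  | zero => exact fun m hm => HasInjectiveDimensionLT.subsingleton K (n + 1) _ (by lia) _
  | succ k ih =>
    intro m hm
    have := ih (m + 1) (by lia)
    refine subsingleton_of_forall_eq 0 fun e => ?_
    have hS := cosyzygySequence_shortExact (iterCosyzygy D m)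
    obtain ⟨x, rfl⟩ := Ext.contravariant_sequence_exact₁ hS K e (n₁ := m + 1 + 1) (by lia)
      (this.elim _ _)
    rw [(h m m).elim x 0, Ext.comp_zero]

end Ext

/-! ### Syzygies with respect to a generator, and the small object argument -/

section Precover

variable {A : Type u} [Category.{v} A] [Abelian A] [IsGrothendieckAbelian.{v} A]

/-- The morphism from a coproduct of copies of `U` determined by a set of morphisms `U ⟶ X`. -/
noncomputable abbrev fromCopower {U X : A} (T : Set (U ⟶ X)) : ∐ (fun _ : T => U) ⟶ X :=
  Sigma.desc fun t => t.1

/-- Since `U` need not be projective, only the morphisms `U ⟶ X` that lift through `q` are kept.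
They still form an epimorphism because they include all composites `U ⟶ P ⟶ X`. -/
lemma exists_lift_fromCopower {U : A} (hU : IsSeparator U) {P X : A} (q : P ⟶ X) [Epi q] :
    ∃ T : Set (U ⟶ X), Epi (fromCopower T) ∧
      ∃ h : ∐ (fun _ : T => U) ⟶ P, h ≫ q = fromCopower T := by
  let T : Set (U ⟶ X) := {f | ∃ l : U ⟶ P, l ≫ q = f}
  choose l hl using fun t : T => t.2
  refine ⟨T, ⟨fun g g' hg => ?_⟩, Sigma.desc l, Sigma.hom_ext _ _ fun t => by simpa using hl t⟩
  rw [← cancel_epi q]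
  refine hU.def _ _ fun k => ?_
  simpa using Sigma.ι (fun _ : T => U) ⟨k ≫ q, k, rfl⟩ ≫= hg

/-- Every extension of `X` by `Z` is a pushout of some `0 ⟶ kernel (fromCopower T) ⟶ ∐ U ⟶ X ⟶ 0`,
where `T` depends on the extension; it splits once the pushout map extends to `∐ U`. -/
lemma subsingleton_ext_one_of_extend {U : A} (hU : IsSeparator U) (X Z : A)
    (h : ∀ T : Set (U ⟶ X), Epi (fromCopower T) → ∀ b : kernel (fromCopower T) ⟶ Z,
      ∃ c, kernel.ι (fromCopower T) ≫ c = b) :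
    Subsingleton (Ext.{v} X Z 1) := by
  rw [subsingleton_ext_one_iff_cosyzygy]
  intro g
  obtain ⟨T, hT, l, hl⟩ := exists_lift_fromCopower hU
    (pullback.snd (cokernel.π (Injective.ι Z)) g)
  let a := l ≫ pullback.fst (cokernel.π (Injective.ι Z)) g
  have ha : a ≫ cokernel.π (Injective.ι Z) = fromCopower T ≫ g := by
    rw [← hl, Category.assoc, pullback.condition, Category.assoc]
  have hS := cosyzygySequence_shortExact Z
  have := hS.mono_f
  obtain ⟨b, hb⟩ : ∃ b : _ ⟶ Z, b ≫ Injective.ι Z = kernel.ι (fromCopower T) ≫ a :=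
    ⟨hS.exact.lift (kernel.ι (fromCopower T) ≫ a) (by
      dsimp
      rw [Category.assoc, ha, kernel.condition_assoc, zero_comp]), hS.exact.lift_f _ _⟩
  obtain ⟨c, hc⟩ := h T hT b
  have hK := shortExact_kernel (fromCopower T)
  have hd : kernel.ι (fromCopower T) ≫ (a - c ≫ Injective.ι Z) = 0 := by
    rw [Preadditive.comp_sub, reassoc_of% hc, hb, sub_self]
  refine ⟨hK.exact.desc (a - c ≫ Injective.ι Z) hd, ?_⟩
  rw [← cancel_epi (fromCopower T)]
  have := hK.exact.g_desc (a - c ≫ Injective.ι Z) hd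
  dsimp at this
  rw [reassoc_of% this, Preadditive.sub_comp, ha]
  simp

/-- The coproduct of the kernels of all epimorphisms onto `X` from coproducts of copies of `U`
indexed by a set of morphisms `U ⟶ X`. -/
noncomputable abbrev totalSyzygy (U X : A) : A :=
  ∐ fun T : {T : Set (U ⟶ X) // Epi (fromCopower T)} => kernel (fromCopower T.1)

lemma subsingleton_ext_kernel_fromCopower (U X Y : A) [Subsingleton (Ext.{v} (totalSyzygy U X) Y 1)]
    (T : Set (U ⟶ X)) (hT : Epi (fromCopower T)) :
    Subsingleton (Ext.{v} (kernel (fromCopower T)) Y 1) :=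
  subsingleton_ext_of_coproduct
    (fun T : {T : Set (U ⟶ X) // Epi (fromCopower T)} => kernel (fromCopower T.1)) Y 1 ⟨T, hT⟩

/-- A morphism from a syzygy to `cosyzygy Y` lifts to the injective hull term and therefore extends
to the copower. No vanishing of `Ext` on `U` is needed. -/
lemma subsingleton_ext_one_cosyzygy {U : A} (hU : IsSeparator U) (X Y : A)
    [Subsingleton (Ext.{v} (totalSyzygy U X) Y 1)] :
    Subsingleton (Ext.{v} X (cosyzygy Y) 1) := by
  refine subsingleton_ext_one_of_extend hU _ _ fun T hT b => ?_
  have := subsingleton_ext_kernel_fromCopower U X Y T hT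
  obtain ⟨l, rfl⟩ := (subsingleton_ext_one_iff_cosyzygy _ _).1 this b
  exact ⟨Injective.factorThru l (kernel.ι _) ≫ cokernel.π _, by
    rw [Injective.comp_factorThru_assoc]⟩

/-- Iterated total syzygies of `W`. -/
noncomputable def iterTotalSyzygy (U W : A) : ℕ → A
  | 0 => W
  | k + 1 => totalSyzygy U (iterTotalSyzygy U W k)

/-- The class of objects `Y` with `Ext¹(N, Y) = 0` for all iterated total syzygies `N` of `W`. -/
def syzygyPerp (U W : A) : ObjectProperty A :=
  fun Y => ∀ k, Subsingleton (Ext.{v} (iterTotalSyzygy U W k) Y 1)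

variable {U W : A}

lemma syzygyPerp_cosyzygy (hU : IsSeparator U) {Y : A} (hY : syzygyPerp U W Y) :
    syzygyPerp U W (cosyzygy Y) := fun k =>
  have : Subsingleton (Ext.{v} (totalSyzygy U (iterTotalSyzygy U W k)) Y 1) := hY (k + 1)
  subsingleton_ext_one_cosyzygy hU _ _

lemma syzygyPerp_iterCosyzygy (hU : IsSeparator U) {Y : A} (hY : syzygyPerp U W Y) (m : ℕ) :
    syzygyPerp U W (iterCosyzygy Y m) := by
  induction m with
  | zero => exact hY
  | succ m ih => exact syzygyPerp_cosyzygy hU ih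

/-- The generating monomorphisms of the cotorsion pair cogenerated by the iterated total
syzygies of `W`: the kernels of the epimorphisms from coproducts of copies of `U`, and `0 ⟶ U`. -/
noncomputable def syzygyMonomorphisms (U W : A) : MorphismProperty A :=
  MorphismProperty.ofHoms
      (fun j : Σ k : ℕ, {T : Set (U ⟶ iterTotalSyzygy U W k) // Epi (fromCopower T)} =>
        kernel.ι (fromCopower j.2.1)) ⊔
    MorphismProperty.ofHoms (fun _ : Unit => (0 : (0 : A) ⟶ U))

instance : MorphismProperty.IsSmall.{v} (syzygyMonomorphisms U W) := by
  have (P Q : MorphismProperty A) [MorphismProperty.IsSmall.{v} P]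
      [MorphismProperty.IsSmall.{v} Q] : MorphismProperty.IsSmall.{v} (P ⊔ Q) :=
    ⟨small_union (s := P.toSet) (t := Q.toSet)⟩
  unfold syzygyMonomorphisms
  infer_instance

lemma syzygyMonomorphisms_le_monomorphisms :
    syzygyMonomorphisms U W ≤ MorphismProperty.monomorphisms A := by
  refine sup_le ?_ ?_ <;> rintro _ _ _ ⟨j⟩
  · exact MorphismProperty.monomorphisms.infer_property (kernel.ι (fromCopower j.2.1))
  · exact MorphismProperty.monomorphisms.infer_property (0 : (0 : A) ⟶ U)

/-- In a Grothendieck abelian category, every small family of monomorphisms permits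
the small object argument. -/
lemma hasSmallObjectArgument_of_le_monomorphisms (I : MorphismProperty A)
    [MorphismProperty.IsSmall.{v} I] (hI : I ≤ MorphismProperty.monomorphisms A) :
    MorphismProperty.HasSmallObjectArgument.{v} I := by
  -- Beyond the number of subobjects of each source, `Hom` out of that source preserves `κ`-indexed
  -- unions of monomorphisms.
  obtain ⟨κ, hκ', hκ⟩ := HasCardinalLT.exists_regular_cardinal_forall.{v}
    (fun i : Shrink.{v} I.toSet => Subobject ((equivShrink _).symm i).1.left)
  have : Fact κ.IsRegular := ⟨hκ'⟩
  have : Nonempty κ.ord.ToType := by simpa using hκ'.ne_zero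
  have := WellFoundedLT.toOrderBot κ.ord.ToType
  exact ⟨κ, inferInstance, inferInstance,
    { preservesColimit {A B X Y} i hi f hf := by
        let hf' : (MorphismProperty.monomorphisms _).TransfiniteCompositionOfShape
            κ.ord.ToType f :=
          { toTransfiniteCompositionOfShape := hf.toTransfiniteCompositionOfShape
            map_mem j hj := by
              have := (hf.attachCells j hj).pushouts_coproducts
              simp only [MorphismProperty.ofHoms_homFamily] at this
              refine (?_ : _ ≤ MorphismProperty.monomorphisms _) _ this
              simp only [MorphismProperty.pushouts_le_iff, MorphismProperty.coproducts_le_iff]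
              exact hI }
        have (j j' : κ.ord.ToType) (φ : j ⟶ j') : Mono (hf'.F.map φ) := hf'.mem_map φ
        have h := hκ (equivShrink _ (⟨Arrow.mk i, hi⟩ : I.toSet))
        rw [Equiv.symm_apply_apply] at h
        exact IsGrothendieckAbelian.preservesColimit_coyoneda_obj_of_mono (Y := hf'.F) (κ := κ) h }⟩

instance : MorphismProperty.HasSmallObjectArgument.{v} (syzygyMonomorphisms U W) :=
  hasSmallObjectArgument_of_le_monomorphisms _ syzygyMonomorphisms_le_monomorphisms

end Precover

/-! ### Completeness of the cogenerated pair -/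

section Completeness

variable {A : Type u} [Category.{v} A] [Abelian A] [IsGrothendieckAbelian.{v} A] {U W : A}

lemma rlp_of_syzygyPerp (hUW : Retract U W) {S : ShortComplex A} (hS : S.ShortExact)
    (h : syzygyPerp U W S.X₁) : (syzygyMonomorphisms U W).rlp S.g := by
  rintro _ _ _ (⟨⟨j⟩⟩ | ⟨⟨_⟩⟩)
  · have := j.2.2
    have := h j.1
    exact hasLiftingProperty_of_subsingleton_ext (shortExact_kernel (fromCopower j.2.1)) hS
  · have : Subsingleton (Ext.{v} W S.X₁ 1) := h 0
    have := subsingleton_ext_of_retract hUW S.X₁ 1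
    exact hasLiftingProperty_of_subsingleton_ext (shortExact_zero_id U) hS

/-- This is what the generating morphism `0 ⟶ U` is for: all morphisms `U ⟶ Y` lift through `p`. -/
lemma epi_of_rlp (hU : IsSeparator U) {X Y : A} {p : X ⟶ Y}
    (hp : (syzygyMonomorphisms U W).rlp p) : Epi p where
  left_cancellation g g' hg := by
    refine hU.def _ _ fun k => ?_
    have := hp _ (Or.inr ⟨⟨⟩⟩)
    have sq : CommSq (0 : 0 ⟶ X) (0 : 0 ⟶ U) p k := ⟨by simp⟩
    rw [← sq.fac_right, Category.assoc, hg, Category.assoc]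

lemma syzygyPerp_kernel_of_rlp (hU : IsSeparator U) {X Y : A} {p : X ⟶ Y}
    (hp : (syzygyMonomorphisms U W).rlp p) : syzygyPerp U W (kernel p) := by
  refine fun k => subsingleton_ext_one_of_extend hU _ _ fun T hT b => ?_
  have : HasLiftingProperty (kernel.ι (fromCopower T)) p := 
    hp _ (Or.inl (MorphismProperty.ofHoms.mk (⟨k, T, hT⟩ :
      Σ k : ℕ, {T : Set (U ⟶ iterTotalSyzygy U W k) // Epi (fromCopower T)})))
  have sq : CommSq (b ≫ kernel.ι p) (kernel.ι (fromCopower T)) p 0 := ⟨by simp⟩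
  exact ⟨kernel.lift p sq.lift sq.fac_right, by simp [← cancel_mono (kernel.ι p)]⟩

/-- For `J` injective, `J ⟶ 0` lifts against all generating morphisms, as these are monomorphisms;
so an embedding `X ⟶ J` factors through `i`. -/
lemma mono_of_llp {X Y : A} {i : X ⟶ Y} (hi : (syzygyMonomorphisms U W).rlp.llp i) : Mono i := by
  have : HasLiftingProperty i (0 : Injective.under X ⟶ 0) := hi _ fun _ _ f hf =>
    have : Mono f := syzygyMonomorphisms_le_monomorphisms f hf
    Injective.hasLiftingProperty_of_isZero f _ (isZero_zero A)
  have sq : CommSq (Injective.ι X) i (0 : Injective.under X ⟶ 0) 0 := ⟨by simp⟩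
  exact mono_of_mono_fac sq.fac_left

/-- The left lifting property, used against `Injective.under Y ⟶ cosyzygy Y` with zero map on
`S.X₁`, gives the required lift from `S.X₃`; this takes the place of a transfinite induction along a
filtration. -/
lemma leftPerp_of_llp (hUW : Retract U W) {S : ShortComplex A} (hS : S.Exact) [Epi S.g]
    (h : (syzygyMonomorphisms U W).rlp.llp S.f) : leftPerp (syzygyPerp U W) S.X₃ := by
  intro Y hY
  rw [subsingleton_ext_one_iff_cosyzygy]
  intro g
  have := h _ (rlp_of_syzygyPerp hUW (cosyzygySequence_shortExact Y) hY)
  have sq : CommSq (0 : S.X₁ ⟶ Injective.under Y) S.f (cosyzygySequence Y).g (S.g ≫ g) :=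
    ⟨by simp⟩
  refine ⟨hS.desc sq.lift sq.fac_left, ?_⟩
  rw [← cancel_epi S.g, hS.g_desc_assoc]
  exact sq.fac_right

/-- The pair cogenerated by the iterated total syzygies of `W` is complete. -/
lemma isCompletePair_syzygyPerp (hU : IsSeparator U) (hUW : Retract U W) :
    IsCompletePair (leftPerp (syzygyPerp U W)) (syzygyPerp U W) where
  exists_left X := by
    let F := MorphismProperty.factorizationData (syzygyMonomorphisms U W).rlp.llp
      (syzygyMonomorphisms U W).rlp (0 : 0 ⟶ X)
    have := epi_of_rlp hU F.hp
    have hi := F.hi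
    rw [(isZero_zero A).eq_of_src F.i 0] at hi
    exact ⟨_, _, _, F.p, kernel.condition _, shortExact_kernel F.p,
      leftPerp_of_llp hUW (shortExact_zero_id F.Z).exact hi,
      syzygyPerp_kernel_of_rlp hU F.hp⟩
  exists_right Y := by
    let F := MorphismProperty.factorizationData (syzygyMonomorphisms U W).rlp.llp
      (syzygyMonomorphisms U W).rlp (0 : Y ⟶ 0)
    have := mono_of_llp F.hi
    have hS := shortExact_cokernel F.i
    refine ⟨_, _, F.i, _, _, hS, leftPerp_of_llp hUW hS.exact F.hi, fun k => ?_⟩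
    have := syzygyPerp_kernel_of_rlp hU F.hp k
    have hp : F.p = 0 := (isZero_zero A).eq_of_tgt _ _
    exact subsingleton_ext_of_iso_right _ (kernelIsoOfEq hp ≪≫ kernelZeroIsoSource) 1

/-- There is an object `D` such that all objects `K` with `Ext¹(D, K) = 0`
are injective. -/
lemma exists_injective_test (A : Type u) [Category.{v} A] [Abelian A]
    [IsGrothendieckAbelian.{v} A] :
    ∃ D : A, ∀ K : A, Subsingleton (Ext.{v} D K 1) → Injective K := by
  let U := separator A
  -- Baer's criterion: it suffices to extend morphisms along the subobjects of a separator, so the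
  -- sum of the corresponding quotients is a test object.
  refine ⟨∐ fun X : Shrink.{v} (Subobject U) => cokernel ((equivShrink _).symm X).arrow,
    fun K hK => ?_⟩
  rw [injective_iff_rlp_monomorphisms_zero,
    ← IsGrothendieckAbelian.generatingMonomorphisms_rlp (isSeparator_separator A)]
  rintro _ _ _ ⟨X⟩
  have := subsingleton_ext_of_coproduct
    (fun X : Shrink.{v} (Subobject U) => cokernel ((equivShrink _).symm X).arrow) K 1
    (equivShrink _ X)
  rw [Equiv.symm_apply_apply] at this
  constructor
  intro f g sq
  obtain ⟨l, hl⟩ := exists_extension (shortExact_cokernel X.arrow) f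
  exact ⟨⟨{ l := l, fac_left := hl, fac_right := (isZero_zero A).eq_of_tgt _ _ }⟩⟩

end Completeness

lemma _root_.WithBot.exists_le_natCast_of_lt_top {a : WithBot ℕ∞} (ha : a < ⊤) :
    ∃ n : ℕ, a ≤ n := by
  induction a with
  | bot => exact ⟨0, bot_le⟩
  | coe a =>
    induction a with
    | top => exact absurd ha (lt_irrefl _)
    | coe a => exact ⟨a, le_rfl⟩

/-! ### Objects of finite projective dimension -/

section FiniteDimension

variable {A : Type u} [Category.{v} A] [Abelian A]

lemma finiteProjDim_iff (X : A) : finiteProjDim A X ↔ ∃ n, HasProjectiveDimensionLT X (n + 1) := by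
  rw [finiteProjDim, lt_top_iff_ne_top, projectiveDimension_ne_top_iff]

lemma finiteProjDim_X₁ {S : ShortComplex A} (hS : S.ShortExact) (h₂ : finiteProjDim A S.X₂)
    (h₃ : finiteProjDim A S.X₃) : finiteProjDim A S.X₁ := by
  obtain ⟨m, hm⟩ := (finiteProjDim_iff _).1 h₂
  obtain ⟨n, hn⟩ := (finiteProjDim_iff _).1 h₃
  exact (finiteProjDim_iff _).2 ⟨max m n, hS.hasProjectiveDimensionLT_X₁ _
    (hasProjectiveDimensionLT_of_ge _ (m + 1) _ (by lia))
    (hasProjectiveDimensionLT_of_ge _ (n + 1) _ (by lia))⟩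

lemma finiteProjDim_X₃ {S : ShortComplex A} (hS : S.ShortExact) (h₁ : finiteProjDim A S.X₁)
    (h₂ : finiteProjDim A S.X₂) : finiteProjDim A S.X₃ := by
  obtain ⟨m, hm⟩ := (finiteProjDim_iff _).1 h₁
  obtain ⟨n, hn⟩ := (finiteProjDim_iff _).1 h₂
  exact (finiteProjDim_iff _).2 ⟨max m n + 1, hS.hasProjectiveDimensionLT_X₃ _
    (hasProjectiveDimensionLT_of_ge _ (m + 1) _ (by lia))
    (hasProjectiveDimensionLT_of_ge _ (n + 1) _ (by lia))⟩

end FiniteDimension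

lemma IsGorensteinCategory.exists_hasDimensionLE {A : Type u} [Category.{v} A] [Abelian A]
    [IsGrothendieckAbelian.{v} A] (hA : IsGorensteinCategory A) : ∃ n : ℕ, HasDimensionLE A n := by
  obtain ⟨m, hm⟩ := WithBot.exists_le_natCast_of_lt_top hA.FPD_lt_top
  obtain ⟨n, hn⟩ := WithBot.exists_le_natCast_of_lt_top hA.FID_lt_top
  exact ⟨max m n, { hA with
    FPD_le := hm.trans (by exact_mod_cast le_max_left m n)
    FID_le := hn.trans (by exact_mod_cast le_max_right m n) }⟩

/-! ### The cotorsion pair `(ℒ, ℒ^⊥)` in a Gorenstein category -/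

namespace HasDimensionLE

variable {A : Type u} [Category.{v} A] [Abelian A] [IsGrothendieckAbelian.{v} A] {n : ℕ}
  (hA : HasDimensionLE A n)

include hA

lemma hasProjectiveDimensionLT {X : A} (hX : finiteProjDim A X) :
    HasProjectiveDimensionLT X (n + 1) :=
  (projectiveDimension_le_iff X n).1 ((le_iSup₂ (f := fun (X : A)
    (_ : projectiveDimension X < ⊤) => projectiveDimension X) X hX).trans hA.FPD_le)

lemma hasInjectiveDimensionLT {X : A} (hX : finiteProjDim A X) :
    HasInjectiveDimensionLT X (n + 1) :=
  (injectiveDimension_le_iff X n).1 ((le_iSup₂ (f := fun (X : A)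
    (_ : injectiveDimension X < ⊤) => injectiveDimension X) X
      ((hA.projDim_lt_top_iff X).1 hX)).trans hA.FID_le)

lemma finiteProjDim_of_injective (X : A) [Injective X] : finiteProjDim A X := by
  refine (hA.projDim_lt_top_iff X).2 ?_
  rw [lt_top_iff_ne_top, injectiveDimension_ne_top_iff]
  exact ⟨0, inferInstanceAs (HasInjectiveDimensionLT X 1)⟩

/-- Infinite coproducts are harmless because `FPD` bounds all summands uniformly by `n`. -/
lemma finiteProjDim_coproduct {ι : Type v} (X : ι → A) (h : ∀ j, finiteProjDim A (X j)) :
    finiteProjDim A (∐ X) :=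
  (finiteProjDim_iff _).2
    ⟨n, hasProjectiveDimensionLT_coproduct X n fun j => hA.hasProjectiveDimensionLT (h j)⟩

lemma finiteProjDim_iterTotalSyzygy {U W : A} (hU : finiteProjDim A U) (hW : finiteProjDim A W)
    (k : ℕ) : finiteProjDim A (iterTotalSyzygy U W k) := by
  induction k with
  | zero => exact hW
  | succ k ih =>
    refine hA.finiteProjDim_coproduct _ fun T => ?_
    have := T.2
    exact finiteProjDim_X₁ (shortExact_kernel (fromCopower T.1))
      (hA.finiteProjDim_coproduct _ fun _ => hU) ih

/-- There are objects `U` and `W` of finite projective dimension such that all objects of finite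
projective dimension in `syzygyPerp U W` are injective. -/
lemma exists_syzygyPerp : ∃ U W : A, IsSeparator U ∧ Nonempty (Retract U W) ∧
    (∀ k, finiteProjDim A (iterTotalSyzygy U W k)) ∧
    ∀ K, finiteProjDim A K → syzygyPerp U W K → Injective K := by
  obtain ⟨U, hU, hU'⟩ := hA.exists_generator
  obtain ⟨D, hD⟩ := exists_injective_test A
  let Q : ULift.{v} ℕ → A := fun m => Injective.under (iterCosyzygy D m.down)
  have hQ : finiteProjDim A (∐ Q) :=
    hA.finiteProjDim_coproduct Q fun _ => hA.finiteProjDim_of_injective _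
  have hW : finiteProjDim A (U ⊞ ∐ Q) := by
    have := hA.hasProjectiveDimensionLT hU'
    have := hA.hasProjectiveDimensionLT hQ
    exact (finiteProjDim_iff _).2 ⟨n, inferInstance⟩
  refine ⟨U, U ⊞ ∐ Q, hU, ⟨⟨biprod.inl, biprod.fst, by simp⟩⟩,
    hA.finiteProjDim_iterTotalSyzygy hU' hW, fun K hK hK' => hD K ?_⟩
  have := hA.hasInjectiveDimensionLT hK
  refine subsingleton_ext_of_hasInjectiveDimensionLT D K n fun m i => ?_
  have : Subsingleton (Ext.{v} (U ⊞ ∐ Q) K (i + 1)) := by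
    -- Closure under cosyzygies upgrades `Ext¹` to all degrees: `Ext^(i+1)(W, K)` is `Ext¹` of `W`
    -- with the `i`-th cosyzygy of `K`. Index `0` selects `W` itself.
    have := syzygyPerp_iterCosyzygy hU hK' i 0
    simpa using (subsingleton_ext_iterCosyzygy_iff (U ⊞ ∐ Q) K i 0).1 this
  have : Subsingleton (Ext.{v} (∐ Q) K (i + 1)) :=
    subsingleton_ext_of_retract (X' := U ⊞ ∐ Q) ⟨biprod.inr, biprod.snd, by simp⟩ K _
  exact subsingleton_ext_of_coproduct Q K _ ⟨m⟩

lemma iterCosyzygy_mem_rightPerp (Y : A) : rightPerp (finiteProjDim A) (iterCosyzygy Y n) := by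
  intro L hL
  have := hA.hasProjectiveDimensionLT hL
  have := (subsingleton_ext_iterCosyzygy_iff L Y n 0).2
    (HasProjectiveDimensionLT.subsingleton L (n + 1) _ (by lia) Y)
  exact this

/-- All `n`-th cosyzygies lie in `P`, and `Ext¹` into them is `Ext^(n+1)` into the original objects.
-/
lemma leftPerp_le_finiteProjDim {P : ObjectProperty A} (hP : rightPerp (finiteProjDim A) ≤ P) :
    leftPerp P ≤ finiteProjDim A := by
  refine fun X hX => (finiteProjDim_iff _).2
    ⟨n, hasProjectiveDimensionLT_of_enoughInjectives X _ fun Y => ?_⟩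
  have : Subsingleton (Ext.{v} X (iterCosyzygy Y n) (0 + 1)) :=
    hX _ (hP _ (hA.iterCosyzygy_mem_rightPerp Y))
  simpa using (subsingleton_ext_iterCosyzygy_iff X Y n 0).1 this

/-- The pair cogenerated by suitable total syzygies is `(ℒ, ℒ^⊥)`. -/
lemma exists_syzygyPerp_eq_rightPerp : ∃ U W : A, IsSeparator U ∧ Nonempty (Retract U W) ∧
    syzygyPerp U W = rightPerp (finiteProjDim A) ∧
    leftPerp (syzygyPerp U W) = finiteProjDim A := by
  obtain ⟨U, W, hU, ⟨hUW⟩, hN, hK⟩ := hA.exists_syzygyPerp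
  have h₁ : rightPerp (finiteProjDim A) ≤ syzygyPerp U W := fun Y hY k => hY _ (hN k)
  have h₂ : leftPerp (syzygyPerp U W) = finiteProjDim A := by
    refine le_antisymm (hA.leftPerp_le_finiteProjDim h₁) fun L hL => ?_
    obtain ⟨K, M, f, g, w, hS, hM, hK'⟩ := (isCompletePair_syzygyPerp hU hUW).exists_left L
    -- The kernel `K` is both in `ℒ` and orthogonal, hence injective; the sequence splits and `L` is
    -- a retract of `M`.
    have := hK K (finiteProjDim_X₁ hS (hA.leftPerp_le_finiteProjDim h₁ _ hM) hL) hK'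
    have s : (ShortComplex.mk f g w).Splitting := hS.splittingOfInjective
    intro Y hY
    have : Subsingleton (Ext.{v} M Y 1) := hM Y hY
    exact subsingleton_ext_of_retract (X' := M) ⟨s.s, g, s.s_g⟩ Y 1
  refine ⟨U, W, hU, ⟨hUW⟩, le_antisymm (fun Y hY L hL => ?_) h₁, h₂⟩
  rw [← h₂] at hL
  exact hL Y hY

lemma rightPerp_iterCosyzygy {Y : A} (hY : rightPerp (finiteProjDim A) Y) (m : ℕ) :
    rightPerp (finiteProjDim A) (iterCosyzygy Y m) := by
  obtain ⟨U, W, hU, -, h, -⟩ := hA.exists_syzygyPerp_eq_rightPerp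
  rw [← h] at hY ⊢
  exact syzygyPerp_iterCosyzygy hU hY m

lemma isCompletePair : IsCompletePair (finiteProjDim A) (rightPerp (finiteProjDim A)) := by
  obtain ⟨U, W, hU, ⟨hUW⟩, h, h'⟩ := hA.exists_syzygyPerp_eq_rightPerp
  have := isCompletePair_syzygyPerp hU hUW
  rwa [h', h] at this

lemma isCotorsionPair : IsCotorsionPair (finiteProjDim A) (rightPerp (finiteProjDim A)) where
  rightPerp_eq := rfl
  leftPerp_eq := by
    obtain ⟨U, W, hU, -, h, h'⟩ := hA.exists_syzygyPerp_eq_rightPerp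
    rw [← h, h']

lemma ext_vanishing {L Y : A} (hL : finiteProjDim A L) (hY : rightPerp (finiteProjDim A) Y)
    (i : ℕ) : Subsingleton (Ext.{v} L Y (i + 1)) := by
  have := hA.rightPerp_iterCosyzygy hY i L hL
  simpa using (subsingleton_ext_iterCosyzygy_iff L Y i 0).1 this

lemma isHereditaryPair : IsHereditaryPair (finiteProjDim A) (rightPerp (finiteProjDim A)) where
  cokernel_mem S hS h₁ h₂ L hL := by
    have := h₂ L hL
    have := hA.ext_vanishing hL h₁ 1
    refine subsingleton_of_forall_eq 0 fun e => ?_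
    obtain ⟨x, rfl⟩ := Ext.covariant_sequence_exact₃ L hS e (n₁ := 2) rfl (Subsingleton.elim _ _)
    rw [Subsingleton.elim x 0, Ext.zero_comp]
  kernel_mem _ hS := finiteProjDim_X₁ hS
  ext_vanishing L Y hL hY i hi := by
    obtain ⟨i, rfl⟩ := Nat.exists_eq_add_of_le' hi
    exact hA.ext_vanishing hL hY i

end HasDimensionLE

/-! ### Splicing exact sequences, and cocycles of complexes of injectives -/

section Splice

universe w'

variable {A : Type u} [Category.{v} A] [Abelian A]

lemma shortExact_kernel_lift {X Y Z : A} {f : X ⟶ Y} {g : Y ⟶ Z} {w : f ≫ g = 0}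
    (h : (ShortComplex.mk f g w).Exact) :
    (ShortComplex.mk (kernel.ι f) (kernel.lift g f w)
      (by simp [← cancel_mono (kernel.ι g)])).ShortExact where
  exact := by
    rw [ShortComplex.exact_iff_exact_up_to_refinements]
    intro T x hx
    have hx' : x ≫ f = 0 := by simpa using hx =≫ kernel.ι g
    exact ⟨T, 𝟙 T, inferInstance, kernel.lift _ x hx', by simp⟩
  epi_g := (ShortComplex.exact_iff_epi_kernel_lift _).1 h

lemma exact_epi_comp_comp_mono {X P Y Q Z : A} (p : X ⟶ P) [Epi p] {f : P ⟶ Y} {g : Y ⟶ Q}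
    {w : f ≫ g = 0} (h : (ShortComplex.mk f g w).ShortExact) (m : Q ⟶ Z) [Mono m] :
    (ShortComplex.mk (p ≫ f) (g ≫ m) (by simp [reassoc_of% w])).Exact := by
  rw [ShortComplex.exact_iff_exact_up_to_refinements]
  intro B x hx
  have hx' : x ≫ g = 0 := by simpa [← cancel_mono m] using hx
  have := h.mono_f
  obtain ⟨B', π, hπ, y, hy⟩ := surjective_up_to_refinements_of_epi p (h.exact.lift x hx')
  refine ⟨B', π, hπ, y, ?_⟩
  have hl := h.exact.lift_f x hx'
  dsimp at hl ⊢
  rw [← reassoc_of% hy, hl]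

/-- Splicing short exact sequences `0 ⟶ Z i ⟶ E i ⟶ Z (i + 1) ⟶ 0` with `E i` injective
and `Ext¹(Q, Z i) = 0` for all injective objects `Q` shows that `Z 0` is Gorenstein injective. -/
lemma gorensteinInjective_of_shortExact [HasExt.{w'} A] (Z E : ℤ → A) (f : ∀ i, Z i ⟶ E i)
    (g : ∀ i, E i ⟶ Z (i + 1)) (w : ∀ i, f i ≫ g i = 0)
    (hS : ∀ i, (ShortComplex.mk (f i) (g i) (w i)).ShortExact) (hE : ∀ i, Injective (E i))
    (hZ : ∀ Q : A, Injective Q → ∀ i, Subsingleton (Ext.{w'} Q (Z i) 1)) :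
    gorensteinInjective (Z 0) := by
  have (i : ℤ) : Mono (f i) := (hS i).mono_f
  have (i : ℤ) : Epi (g i) := (hS i).epi_g
  have sq (i : ℤ) : (g i ≫ f (i + 1)) ≫ g (i + 1) ≫ f (i + 1 + 1) = 0 := by
    rw [Category.assoc, reassoc_of% (w (i + 1)), zero_comp, comp_zero]
  refine ⟨CochainComplex.of E (fun i => g i ≫ f (i + 1)) sq,
    { injective := hE, acyclic := ?_, hom_exact := ?_ }, ⟨?_⟩⟩
  · intro j
    obtain ⟨i, rfl⟩ : ∃ i, i + 1 = j := ⟨j - 1, by simp⟩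
    rw [HomologicalComplex.exactAt_iff' _ i (i + 1) (i + 1 + 1) (by simp) (by simp)]
    refine (ShortComplex.exact_iff_of_iso (S₁ := ShortComplex.mk _ _ (sq i))
      (S₂ := (CochainComplex.of E (fun i => g i ≫ f (i + 1)) sq).sc' i (i + 1) (i + 1 + 1))
      (ShortComplex.isoMk (Iso.refl _) (Iso.refl _) (Iso.refl _) ?_ ?_)).1
      (exact_epi_comp_comp_mono (g i) (hS (i + 1)) (f (i + 1 + 1)))
    · exact (Category.id_comp _).trans
        ((CochainComplex.of_d E (fun i => g i ≫ f (i + 1)) i).trans (Category.comp_id _).symm)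
    · exact (Category.id_comp _).trans
        ((CochainComplex.of_d E (fun i => g i ≫ f (i + 1)) (i + 1)).trans (Category.comp_id _).symm)
  · rintro Q hQ i _ _ rfl rfl a ha
    -- A cocycle `a` factors through `Z (i + 1)`, and then lifts to `E i` because `Ext¹(Q, Z i) =
    -- 0`.
    have ha' : a ≫ g (i + 1) = 0 := by
      rw [← cancel_mono (f (i + 1 + 1)), zero_comp, Category.assoc]
      simpa using ha
    have := hZ Q hQ i
    obtain ⟨b, hb⟩ := exists_lift (hS i) ((hS (i + 1)).exact.lift a ha')
    refine ⟨b, ?_⟩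
    dsimp at hb
    simp only [CochainComplex.of_d]
    rw [reassoc_of% hb]
    exact (hS (i + 1)).exact.lift_f a ha'
  · have h := isKernelCompMono (hS 0).fIsKernel (f (0 + 1)) rfl
    refine h.conePointUniqueUpToIso (kernelIsKernel _) ≪≫ kernelIsoOfEq ?_
    exact (CochainComplex.of_d E (fun i => g i ≫ f (i + 1)) 0).symm

/-- If `L` has finite projective dimension, then `Ext¹(L, -)` vanishes on the cocycles of
an exact complex of injective objects. -/
lemma subsingleton_ext_kernel_of_acyclic [HasExt.{w'} A] (E : CochainComplex A ℤ)
    (hE : ∀ i, Injective (E.X i)) (hE' : E.Acyclic) (L : A) (n : ℕ)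
    [HasProjectiveDimensionLT L (n + 1)] (j : ℤ) :
    Subsingleton (Ext.{w'} L (kernel (E.d j (j + 1))) 1) := by
  -- Each step back in the complex raises the `Ext` degree by one; since the complex is unbounded to
  -- the left, degrees above `n` are reached from every `j`.
  suffices ∀ k i, n ≤ i + k → ∀ j : ℤ,
      Subsingleton (Ext.{w'} L (kernel (E.d j (j + 1))) (i + 1)) from this n 0 (by lia) j
  intro k
  induction k with
  | zero => exact fun i hi j => HasProjectiveDimensionLT.subsingleton L (n + 1) _ (by lia) _
  | succ k ih =>
    intro i hi j
    obtain ⟨j, rfl⟩ : ∃ i, i + 1 = j := ⟨j - 1, by simp⟩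
    have hS := shortExact_kernel_lift ((HomologicalComplex.exactAt_iff' E j (j + 1) (j + 1 + 1)
      (by simp) (by simp)).1 (hE' (j + 1)))
    have := hE j
    exact (subsingleton_ext_succ_iff hS L i).1 (ih (i + 1) (by lia) j)

lemma subsingleton_ext_kernel_injectiveResolution_iff [HasExt.{w'} A] {Y : A}
    (I : InjectiveResolution Y) (L : A) (m i : ℕ) :
    Subsingleton (Ext.{w'} L (kernel (I.cocomplex.d m (m + 1))) (i + 1)) ↔
      Subsingleton (Ext.{w'} L Y (i + m + 1)) := by
  induction m generalizing i with
  | zero =>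
    have e : Y ≅ kernel (I.cocomplex.d 0 1) :=
      I.isLimitKernelFork.conePointUniqueUpToIso (limit.isLimit _)
    exact ⟨fun _ => subsingleton_ext_of_iso_right L e.symm _,
      fun _ => subsingleton_ext_of_iso_right L e _⟩
  | succ m ih =>
    have hS := shortExact_kernel_lift (I.exact_succ m)
    have := I.injective m
    rw [show i + (m + 1) + 1 = i + 1 + m + 1 by lia, ← ih (i + 1)]
    exact (subsingleton_ext_succ_iff hS L i).symm

end Splice

/-! ### `ℒ^⊥` and the Gorenstein injective objects -/

namespace HasDimensionLE

variable {A : Type u} [Category.{v} A] [Abelian A] [IsGrothendieckAbelian.{v} A] {n : ℕ}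
  (hA : HasDimensionLE A n)

include hA

lemma rightPerp_of_gorensteinInjective {G : A} (hG : gorensteinInjective G) :
    rightPerp (finiteProjDim A) G := by
  obtain ⟨E, hE, ⟨e⟩⟩ := hG
  intro L hL
  have := hA.hasProjectiveDimensionLT hL
  have : Subsingleton (Ext.{v} L (kernel (E.d 0 1)) 1) :=
    subsingleton_ext_kernel_of_acyclic E hE.injective hE.acyclic L n 0
  exact subsingleton_ext_of_iso_right L e.symm 1

/-- An object of `ℒ^⊥` is a quotient of an injective object by an object of `ℒ^⊥`. -/
lemma exists_injective_shortExact {G : A} (hG : rightPerp (finiteProjDim A) G) :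
    ∃ (K E : A) (f : K ⟶ E) (g : E ⟶ G) (w : f ≫ g = 0),
      (ShortComplex.mk f g w).ShortExact ∧ Injective E ∧ rightPerp (finiteProjDim A) K := by
  obtain ⟨K, E, f, g, w, hS, hE, hK⟩ := hA.isCompletePair.exists_left G
  refine ⟨K, E, f, g, w, hS, ?_, hK⟩
  -- The middle term `E` is in `ℒ`, hence so is its cosyzygy; and `E` is in `ℒ^⊥` as an extension of
  -- `G` by `K`. So `E` splits off its injective envelope term.
  have hE' : Subsingleton (Ext.{v} (cosyzygy E) E 1) := by
    have hC : finiteProjDim A (cosyzygy E) := finiteProjDim_X₃ (cosyzygySequence_shortExact E) hE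
      (hA.finiteProjDim_of_injective (Injective.under E))
    have := hK _ hC
    have := hG _ hC
    refine subsingleton_of_forall_eq 0 fun e => ?_
    obtain ⟨x, rfl⟩ := Ext.covariant_sequence_exact₂ _ hS e (Subsingleton.elim _ _)
    rw [Subsingleton.elim x 0, Ext.zero_comp]
  obtain ⟨r, hr⟩ := exists_extension (cosyzygySequence_shortExact E) (𝟙 E)
  exact Retract.injective ⟨Injective.ι E, r, hr⟩

lemma gorensteinInjective_of_rightPerp {G : A} (hG : rightPerp (finiteProjDim A) G) :
    gorensteinInjective G := by
  choose K E f g w hS hE hK using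
    fun G : Subtype (rightPerp (finiteProjDim A)) => hA.exists_injective_shortExact G.2
  -- Cosyzygies of `G` in degrees `≥ 0`, iterated kernels of special precovers in degrees `< 0`;
  -- `negSucc k` is degree `-(k + 1)`, whence `k + 1` iterations.
  let Z : ℤ → A
    | .ofNat k => iterCosyzygy G k
    | .negSucc k => (Nat.iterate (fun G => ⟨K G, hK G⟩) (k + 1)
        (⟨G, hG⟩ : Subtype (rightPerp (finiteProjDim A)))).1
  have hZ (i : ℤ) : rightPerp (finiteProjDim A) (Z i) := by
    cases i with
    | ofNat k => exact hA.rightPerp_iterCosyzygy hG k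
    | negSucc k => exact Subtype.prop _
  have h (i : ℤ) : ∃ (E : A) (f : Z i ⟶ E) (g : E ⟶ Z (i + 1)) (w : f ≫ g = 0),
      (ShortComplex.mk f g w).ShortExact ∧ Injective E := by
    obtain k | k := i
    · exact ⟨_, _, _, _, cosyzygySequence_shortExact (iterCosyzygy G k),
        inferInstanceAs (Injective (Injective.under _))⟩
    · have hk : Z (Int.negSucc k + 1) = (Nat.iterate (fun G => ⟨K G, hK G⟩) k
          (⟨G, hG⟩ : Subtype (rightPerp (finiteProjDim A)))).1 := by
        cases k <;> rfl
      have hk' : Z (Int.negSucc k) = K (Nat.iterate (fun G => ⟨K G, hK G⟩) k ⟨G, hG⟩) :=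
        congrArg Subtype.val (Function.iterate_succ_apply' _ _ _)
      rw [hk, hk']
      exact ⟨_, _, _, _, hS _, hE _⟩
  choose E' f' g' w' hS' hE' using h
  exact gorensteinInjective_of_shortExact Z E' f' g' w' hS' hE' fun Q hQ i =>
    hZ i Q (hA.finiteProjDim_of_injective Q)

lemma rightPerp_finiteProjDim_eq : rightPerp (finiteProjDim A) = gorensteinInjective :=
  le_antisymm (fun _ => hA.gorensteinInjective_of_rightPerp)
    fun _ => hA.rightPerp_of_gorensteinInjective

lemma Gid_le (Y : A) : Gid Y ≤ n := by
  -- The `n`-th cocycle object of any injective resolution is in `ℒ^⊥`, since `Ext¹(L, -)` of it is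
  -- `Ext^(n+1)(L, Y) = 0` for `L ∈ ℒ`.
  refine iInf₂_le (f := fun (m : ℕ) _ => (m : ℕ∞)) n
    ⟨InjectiveResolution.of Y, hA.gorensteinInjective_of_rightPerp fun L hL => ?_⟩
  have := hA.hasProjectiveDimensionLT hL
  exact (subsingleton_ext_kernel_injectiveResolution_iff (InjectiveResolution.of Y) L n 0).2
    (HasProjectiveDimensionLT.subsingleton L (n + 1) _ (by lia) Y)

end HasDimensionLE

end GorensteinCat

theorem mainTheorem1 (A : Type u) [Category.{v} A]
    [Abelian A] [IsGrothendieckAbelian.{v} A]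
    (hA : GorensteinCat.IsGorensteinCategory A) :
    (GorensteinCat.IsCotorsionPair (GorensteinCat.finiteProjDim A)
        (GorensteinCat.rightPerp (GorensteinCat.finiteProjDim A)) ∧
      GorensteinCat.IsCompletePair (GorensteinCat.finiteProjDim A)
        (GorensteinCat.rightPerp (GorensteinCat.finiteProjDim A)) ∧
      GorensteinCat.IsHereditaryPair (GorensteinCat.finiteProjDim A)
        (GorensteinCat.rightPerp (GorensteinCat.finiteProjDim A))) ∧
    GorensteinCat.rightPerp (GorensteinCat.finiteProjDim A) =
      GorensteinCat.gorensteinInjective ∧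
    ∀ n : ℕ, GorensteinCat.HasDimensionLE A n → ∀ Y : A, GorensteinCat.Gid Y ≤ n := by
  obtain ⟨n, hn⟩ := hA.exists_hasDimensionLE
  exact ⟨⟨hn.isCotorsionPair, hn.isCompletePair, hn.isHereditaryPair⟩,
    hn.rightPerp_finiteProjDim_eq, fun _ hm => hm.Gid_le⟩
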